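/- All matroids are finite. Matroids $M$ on $A$ and $N$ on $B$ are matched if $M/(A-B)=N|(A\cap B)$. The free splice $M\Join N$ of matched matroids is the matroid on $A\cup B$ obtained as the Higgs lift, with index $i=r_M(A-B)$, of $N\oplus I^*(A-B)$ ($N$ with the elements of $A-B$ added as loops) towards $M\oplus I(B-A)$ ($M$ with the elements of $B-A$ added as isthmuses), that is, its rank function is $$r(X)=\min\{r_M(X\cap A)+|X-A|,\ r_N(X\cap B)+r_M(A-B)\}\qquad (X\subseteq A\cup B).$$ A matroid $L$ on $E$ is irreducible if there are no sets $A,B$ with $A\cup B=E$, $A-B\neq\emptyset$, $B-A\neq\emptyset$ and $L=(L|A)\Join(L/(E-B))$. Let $\mathcal N$ be the class of matroids obtained from loops and isthmuses (one-element matroids of rank $0$ and $1$) by repeatedly taking free splices of matched matroids. A transversal matroid is fundamental if it has a presentation $(A_1,\dots,A_r)$ such that for each $i$ some element of the matroid is in $A_i$ and in no other $A_j$ (in other words, it has a representation on a simplex, with each element placed freely on a face, loops on the empty face, in which there is an element at each vertex). Then the following statements hold. 1. Every fundamental transversal matroid on a nonempty set is in $\mathcal N$. 2. If $M\in\mathcal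 N$, then $M^*\in\mathcal N$. 3. $\mathcal N$ is not closed under taking minors: some matroid in $\mathcal N$ has a minor on a nonempty set that is not in $\mathcal N$. 4. Specifically, let $n\ge 5$, let $B_n$ be the bicircular matroid that has one element at each vertex and one element freely on each edge of the simplex with $n$ vertices (the transversal matroid on $\{\{i,j\}: 1\le i\le j\le n\}$ with presentation $(A_1,\dots,A_n)$, $A_v=\{e: v\in e\}$), and let $B'_n$ be its restriction to the $\binom n2$ elements on the edges, $i<j$. Then $B_n\in\mathcal N$, while $B'_n$ is irreducible and is not in $\mathcal N$. -/

import Mathlib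

open Set

namespace Matroid

variable {α : Type*}

/-! ### Splices and the free splice -/

/-- The contraction of `M` to `X` (written `M.X`), that is, `M / (E(M) - X)`. -/
def contractTo (M : Matroid α) (X : Set α) : Matroid α := M.contract (M.E \ X)

/-- The ordered pair `(M, N)` of matroids on `A = M.E` and `B = N.E` is matched if the contraction
of `M` to `A ∩ B` equals the restriction of `N` to `A ∩ B`. -/
def Matched (M N : Matroid α) : Prop :=
  M.contractTo (M.E ∩ N.E) = N.restrict (M.E ∩ N.E)

/-- `M ⊕ I(S - E(M))`: the elements of `S` that are not in `M` are adjoined as isthmuses. -/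
def addIsthmuses (M : Matroid α) (S : Set α) : Matroid α :=
  M.disjointSum (freeOn (S \ M.E)) (by rw [freeOn_ground]; exact disjoint_sdiff_right)

/-- `M ⊕ I*(S - E(M))`: the elements of `S` that are not in `M` are adjoined as loops. -/
def addLoops (M : Matroid α) (S : Set α) : Matroid α :=
  M.disjointSum (loopyOn (S \ M.E)) (by rw [loopyOn_ground]; exact disjoint_sdiff_right)

/-- `L` is the `i`-th Higgs lift of `N` towards `M`, where `N` is a quotient of `M` (in particular
they have the same ground set): it is the matroid on the common ground set with rank function
`min {r_M, r_N + i}`. -/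
def IsHiggsLift (L M N : Matroid α) (i : ℕ∞) : Prop :=
  L.E = M.E ∧ ∀ X ⊆ M.E, L.eRk X = min (M.eRk X) (N.eRk X + i)

/-- `L` is the free splice of `M` and `N`, where `M` and `N` are finite matched matroids on
`A = M.E` and `B = N.E`: it is the Higgs lift of `N ⊕ I*(A - B)` towards `M ⊕ I(B - A)` of index
`r_M(A - B)`. It exists and is unique, see `existsUnique_isFreeSplice`. -/
structure IsFreeSplice (L M N : Matroid α) : Prop where
  finite_left : M.E.Finite
  finite_right : N.E.Finite
  matched : Matched M N
  higgs : IsHiggsLift L (M.addIsthmuses N.E) (N.addLoops M.E) (M.eRk (M.E \ N.E))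

/-! ### The free splice is well defined -/

theorem disjointSum_eRk (M N : Matroid α) (h : Disjoint M.E N.E) (X : Set α) :
    (M.disjointSum N h).eRk X = M.eRk X + N.eRk X := by
  obtain ⟨I, hI⟩ := M.exists_isBasis (X ∩ M.E)
  obtain ⟨J, hJ⟩ := N.exists_isBasis (X ∩ N.E)
  have hIE := hI.indep.subset_ground
  have hJE := hJ.indep.subset_ground
  have hB : (M.disjointSum N h).IsBasis (I ∪ J) (X ∩ (M.disjointSum N h).E) := by
    have e1 : (I ∪ J) ∩ M.E = I := by
      rw [union_inter_distrib_right, inter_eq_self_of_subset_left hIE,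
        (h.symm.mono_left hJE).inter_eq, union_empty]
    have e2 : (I ∪ J) ∩ N.E = J := by
      rw [union_inter_distrib_right, inter_eq_self_of_subset_left hJE,
        (h.mono_left hIE).inter_eq, empty_union]
    have e3 : X ∩ (M.E ∪ N.E) ∩ M.E = X ∩ M.E := by
      ext x; simp; tauto
    have e4 : X ∩ (M.E ∪ N.E) ∩ N.E = X ∩ N.E := by
      ext x; simp; tauto
    rw [disjointSum_isBasis_iff, disjointSum_ground_eq, e1, e2, e3, e4]
    refine ⟨hI, hJ, ?_, inter_subset_right⟩
    rw [inter_union_distrib_left]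
    exact union_subset_union hI.subset hJ.subset
  rw [← eRk_inter_ground, ← hB.encard_eq_eRk, ← M.eRk_inter_ground, ← hI.encard_eq_eRk,
    ← N.eRk_inter_ground, ← hJ.encard_eq_eRk, encard_union_eq]
  exact (h.mono_left hIE).mono_right hJE

theorem contract_eRk_add (M : Matroid α) (X C : Set α) :
    (M.contract C).eRk X + M.eRk C = M.eRk (X ∪ C) := by
  obtain ⟨I, hI⟩ := M.exists_isBasis' C
  obtain ⟨J, hJ, hIJ⟩ := hI.indep.subset_isBasis'_of_subset
    (hI.subset.trans (subset_union_right (s := X)))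
  have hJC : J ∩ C = I := (hI.eq_of_subset_indep (hJ.indep.inter_right C)
    (subset_inter hIJ hI.subset) inter_subset_right).symm
  have hJI : J \ C ∪ I = J := by rw [← hJC, sdiff_union_inter]
  have h := hJ.contract_isBasis' hI (by rw [hJI]; exact hJ.indep)
  have h1 : (M.contract C).eRk ((X ∪ C) \ C) = (M.contract C).eRk X := by
    rw [← eRk_inter_ground, ← (M.contract C).eRk_inter_ground X]
    congr 1
    ext x; simp; tauto
  rw [← h1, ← h.encard_eq_eRk, ← hI.encard_eq_eRk, ← hJ.encard_eq_eRk,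
    ← encard_union_eq (disjoint_sdiff_left.mono_right hI.subset), hJI]

theorem addIsthmuses_eRk (M : Matroid α) {S X : Set α} (hX : X ⊆ M.E ∪ S) :
    (M.addIsthmuses S).eRk X = M.eRk X + (X \ M.E).encard := by
  rw [addIsthmuses, disjointSum_eRk, ← (freeOn _).eRk_inter_ground, freeOn_ground,
    eRk_freeOn inter_subset_right]
  congr 2
  ext x
  have := @hX x
  simp at this ⊢
  tauto

theorem addLoops_eRk (M : Matroid α) (S X : Set α) :
    (M.addLoops S).eRk X = M.eRk X := by
  rw [addLoops, disjointSum_eRk, eRk_loopyOn, add_zero]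

/-- The rank function of the free splice. -/
theorem isFreeSplice_iff {L M N : Matroid α} :
    IsFreeSplice L M N ↔ M.E.Finite ∧ N.E.Finite ∧ Matched M N ∧ L.E = M.E ∪ N.E ∧
      ∀ X ⊆ M.E ∪ N.E,
        L.eRk X = min (M.eRk X + (X \ M.E).encard) (N.eRk X + M.eRk (M.E \ N.E)) := by
  have hE : (M.addIsthmuses N.E).E = M.E ∪ N.E := by simp [addIsthmuses]
  have key : IsHiggsLift L (M.addIsthmuses N.E) (N.addLoops M.E) (M.eRk (M.E \ N.E)) ↔
      L.E = M.E ∪ N.E ∧ ∀ X ⊆ M.E ∪ N.E,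
        L.eRk X = min (M.eRk X + (X \ M.E).encard) (N.eRk X + M.eRk (M.E \ N.E)) := by
    rw [IsHiggsLift, hE]
    refine and_congr_right fun _ ↦ forall₂_congr fun X hX ↦ ?_
    rw [addIsthmuses_eRk M hX, addLoops_eRk]
  exact ⟨fun h ↦ ⟨h.1, h.2, h.3, key.1 h.4⟩, fun h ↦ ⟨h.1, h.2.1, h.2.2.1, key.2 h.2.2.2⟩⟩

theorem exists_matroid_of_rank {E : Set α} (hE : E.Finite) (f : Set α → ℕ) (h0 : f ∅ = 0)
    (hmono : ∀ X ⊆ E, ∀ e ∈ E, f X ≤ f (insert e X))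
    (hunit : ∀ X ⊆ E, ∀ e ∈ E, f (insert e X) ≤ f X + 1)
    (hdr : ∀ X Y, X ⊆ Y → Y ⊆ E → ∀ e ∈ E, f (insert e Y) + f X ≤ f Y + f (insert e X)) :
    ∃ L : Matroid α, L.E = E ∧ ∀ X ⊆ E, L.eRk X = f X := by
  have hle : ∀ X ⊆ E, f X ≤ X.ncard := by
    intro X hX
    induction X, hE.subset hX using Set.Finite.induction_on with
    | empty => simp [h0]
    | @insert e X he hfin ih =>
      rw [insert_subset_iff] at hX
      rw [ncard_insert_of_notMem he hfin]
      have := hunit X hX.2 e hX.1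
      have := ih hX.2
      omega
  have hmono' : ∀ X Y, X ⊆ Y → Y ⊆ E → f X ≤ f Y := by
    intro X Y hXY hY
    have key : ∀ K, K.Finite → K ⊆ E → f X ≤ f (X ∪ K) := by
      intro K hK
      induction K, hK using Set.Finite.induction_on with
      | empty => simp
      | @insert e K he hfin ih =>
        intro hK
        rw [insert_subset_iff] at hK
        rw [union_insert]
        exact (ih hK.2).trans (hmono _ (union_subset (hXY.trans hY) hK.2) e hK.1)
    have := key Y (hE.subset hY) hY
    rwa [union_eq_self_of_subset_left hXY] at this
  have hspan : ∀ I K, I ⊆ E → K ⊆ E → (∀ e ∈ K, f (insert e I) = f I) → f (I ∪ K) = f I := by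
    intro I K hI hK
    induction K, hE.subset hK using Set.Finite.induction_on with
    | empty => simp
    | @insert e K he hfin ih =>
      intro h
      rw [insert_subset_iff] at hK
      have h1 := ih hK.2 (fun x hx ↦ h x (Or.inr hx))
      have h2 := h e (Or.inl rfl)
      have h3 := hdr I (I ∪ K) subset_union_left (union_subset hI hK.2) e hK.1
      have h4 := hmono (I ∪ K) (union_subset hI hK.2) e hK.1
      rw [union_insert]
      omega
  have hext : ∀ I ⊆ E, f I = I.ncard → ∀ e ∈ E, e ∉ I → f (insert e I) ≠ (insert e I).ncard →
      f (insert e I) = f I := by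
    intro I hI hfI e he heI hne
    have h1 := hunit I hI e he
    have h2 := hmono I hI e he
    rw [ncard_insert_of_notMem heI (hE.subset hI)] at hne
    omega
  let P : IndepMatroid α := IndepMatroid.ofFinite hE (fun I ↦ I ⊆ E ∧ f I = I.ncard)
    ⟨empty_subset _, by simp [h0]⟩
    (by
      rintro I J ⟨hJ, hfJ⟩ hIJ
      refine ⟨hIJ.trans hJ, le_antisymm (hle I (hIJ.trans hJ)) ?_⟩
      have key : ∀ K, K.Finite → Disjoint I K → K ⊆ E → f (I ∪ K) ≤ f I + K.ncard := by
        intro K hK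
        induction K, hK using Set.Finite.induction_on with
        | empty => simp
        | @insert e K he hfin ih =>
          intro hd hK
          rw [insert_subset_iff] at hK
          rw [union_insert, ncard_insert_of_notMem he hfin]
          have := hunit (I ∪ K) (union_subset (hIJ.trans hJ) hK.2) e hK.1
          have := ih (hd.mono_right (subset_insert _ _)) hK.2
          omega
      have h1 := key (J \ I) ((hE.subset hJ).subset sdiff_subset) disjoint_sdiff_right
        (sdiff_subset.trans hJ)
      rw [union_sdiff_cancel hIJ] at h1
      have h2 := ncard_sdiff_add_ncard_of_subset hIJ (hE.subset hJ)
      omega)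
    (by
      rintro I J ⟨hI, hfI⟩ ⟨hJ, hfJ⟩ hlt
      by_contra! hcon
      have := hspan I J hI hJ (fun e he ↦ by
        by_cases heI : e ∈ I
        · rw [insert_eq_of_mem heI]
        · exact hext I hI hfI e (hJ he) heI
            (hcon e he heI (insert_subset (hJ he) hI)))
      have := hmono' J (I ∪ J) subset_union_right (union_subset hI hJ)
      omega)
    (fun I h ↦ h.1)
  refine ⟨P.matroid, rfl, fun X hX ↦ ?_⟩
  have hind : ∀ I, P.matroid.Indep I ↔ I ⊆ E ∧ f I = I.ncard := fun I ↦ by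
    simp [P, IndepMatroid.ofFinite, IndepMatroid.ofBddAugment, IndepMatroid.ofBdd]
  obtain ⟨I, hI⟩ := P.matroid.exists_isBasis' X
  obtain ⟨hIE, hfI⟩ := (hind I).1 hI.indep
  rw [hI.eRk_eq_encard, ← (hE.subset hIE).cast_ncard_eq, ← hfI]
  have := hspan I X hIE hX (fun e he ↦ by
    by_cases heI : e ∈ I
    · rw [insert_eq_of_mem heI]
    · refine hext I hIE hfI e (hX he) heI fun h ↦ heI ?_
      exact hI.mem_of_insert_indep he ((hind _).2 ⟨insert_subset (hX he) hIE, h⟩))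
  rw [union_eq_self_of_subset_left hI.subset] at this
  rw [this]


/-- The free splice of finite matched matroids exists and is unique. -/
theorem existsUnique_isFreeSplice {M N : Matroid α} (hM : M.E.Finite) (hN : N.E.Finite)
    (h : Matched M N) : ∃! L, IsFreeSplice L M N := by
  have hMf : M.RankFinite := ⟨by
    obtain ⟨B, hB⟩ := M.exists_isBase
    exact ⟨B, hB, hM.subset hB.subset_ground⟩⟩
  have hNf : N.RankFinite := ⟨by
    obtain ⟨B, hB⟩ := N.exists_isBase
    exact ⟨B, hB, hN.subset hB.subset_ground⟩⟩
  have hE : (M.E ∪ N.E).Finite := hM.union hN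
  set A := M.E with hA
  set B := N.E with hB
  obtain ⟨g, hg⟩ : ∃ g : Set α → ℕ, ∀ X, M.eRk X = g X := ⟨fun X ↦ (M.eRk X).toNat, fun X ↦ by
    rw [ENat.natCast_toNat]; exact eRk_ne_top_iff.2 (M.isRkFinite_set X)⟩
  obtain ⟨k, hk⟩ : ∃ g : Set α → ℕ, ∀ X, N.eRk X = g X := ⟨fun X ↦ (N.eRk X).toNat, fun X ↦ by
    rw [ENat.natCast_toNat]; exact eRk_ne_top_iff.2 (N.isRkFinite_set X)⟩
  have gmono : ∀ X Y, X ⊆ Y → g X ≤ g Y := fun X Y hXY ↦ by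
    have := M.eRk_mono hXY; rw [hg, hg] at this; exact_mod_cast this
  have kmono : ∀ X Y, X ⊆ Y → k X ≤ k Y := fun X Y hXY ↦ by
    have := N.eRk_mono hXY; rw [hk, hk] at this; exact_mod_cast this
  have gunit : ∀ X e, g (insert e X) ≤ g X + 1 := fun X e ↦ by
    have := M.eRk_insert_le_add_one e X; rw [hg, hg] at this; exact_mod_cast this
  have kunit : ∀ X e, k (insert e X) ≤ k X + 1 := fun X e ↦ by
    have := N.eRk_insert_le_add_one e X; rw [hk, hk] at this; exact_mod_cast this
  have gdr : ∀ X Y, X ⊆ Y → ∀ e, g (insert e Y) + g X ≤ g Y + g (insert e X) :=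
      fun X Y hXY e ↦ by
    have h1 := M.eRk_inter_add_eRk_union_le Y (insert e X)
    simp only [hg] at h1
    have h2 : g X ≤ g (Y ∩ insert e X) := gmono _ _ (subset_inter hXY (subset_insert _ _))
    have h3 : Y ∪ insert e X = insert e Y := by
      rw [union_insert, union_eq_self_of_subset_right hXY]
    rw [h3] at h1
    norm_cast at h1
    omega
  have kdr : ∀ X Y, X ⊆ Y → ∀ e, k (insert e Y) + k X ≤ k Y + k (insert e X) :=
      fun X Y hXY e ↦ by
    have h1 := N.eRk_inter_add_eRk_union_le Y (insert e X)
    simp only [hk] at h1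
    have h2 : k X ≤ k (Y ∩ insert e X) := kmono _ _ (subset_inter hXY (subset_insert _ _))
    have h3 : Y ∪ insert e X = insert e Y := by
      rw [union_insert, union_eq_self_of_subset_right hXY]
    rw [h3] at h1
    norm_cast at h1
    omega
  have gnot : ∀ X e, e ∉ A → g (insert e X) = g X := fun X e he ↦ by
    have := M.eRk_insert_of_notMem_ground X he; rw [hg, hg] at this; exact_mod_cast this
  have knot : ∀ X e, e ∉ B → k (insert e X) = k X := fun X e he ↦ by
    have := N.eRk_insert_of_notMem_ground X he; rw [hk, hk] at this; exact_mod_cast this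
  -- ranks on the common part
  have hcommon : ∀ X ⊆ A ∩ B, k X + g (A \ B) = g (X ∪ (A \ B)) := by
    intro X hX
    have h1 := M.contract_eRk_add X (A \ B)
    have h2 : M.contract (A \ B) = N.restrict (A ∩ B) := by
      have := h
      rwa [Matched, contractTo, ← hA, ← hB, sdiff_self_inter] at this
    rw [h2, restrict_eRk_eq _ hX, hk, hg, hg] at h1
    exact_mod_cast h1
  -- the lifted rank function of `M`
  set G : Set α → ℕ := fun X ↦ g X + (X \ A).ncard with hG
  have Gin : ∀ X e, e ∈ A → G (insert e X) = g (insert e X) + (X \ A).ncard := fun X e he ↦ by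
    simp only [hG]
    rw [insert_sdiff_of_mem _ he]
  have Gout : ∀ X ⊆ A ∪ B, ∀ e ∉ A, e ∉ X → G (insert e X) = G X + 1 := fun X hX e he heX ↦ by
    simp only [hG]
    rw [insert_sdiff_of_notMem _ he, gnot X e he, ncard_insert_of_notMem (fun hh ↦ heX hh.1)
      ((hE.subset hX).subset sdiff_subset), add_assoc]
  have Gmono1 : ∀ X ⊆ A ∪ B, ∀ e ∈ A ∪ B, G X ≤ G (insert e X) := fun X hX e he ↦ by
    by_cases heX : e ∈ X
    · rw [insert_eq_of_mem heX]
    by_cases heA : e ∈ A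
    · rw [Gin X e heA]
      have := gmono X (insert e X) (subset_insert _ _)
      simp only [hG]; omega
    · rw [Gout X hX e heA heX]; omega
  have Gunit1 : ∀ X ⊆ A ∪ B, ∀ e ∈ A ∪ B, G (insert e X) ≤ G X + 1 := fun X hX e he ↦ by
    by_cases heX : e ∈ X
    · rw [insert_eq_of_mem heX]; omega
    by_cases heA : e ∈ A
    · rw [Gin X e heA]
      have := gunit X e
      simp only [hG]; omega
    · rw [Gout X hX e heA heX]
  have Gdr : ∀ X Y, X ⊆ Y → Y ⊆ A ∪ B → ∀ e ∈ A ∪ B,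
      G (insert e Y) + G X ≤ G Y + G (insert e X) := fun X Y hXY hY e he ↦ by
    by_cases heY : e ∈ Y
    · rw [insert_eq_of_mem heY]
      have := Gmono1 X (hXY.trans hY) e he
      omega
    have heX : e ∉ X := fun hh ↦ heY (hXY hh)
    by_cases heA : e ∈ A
    · rw [Gin X e heA, Gin Y e heA]
      have := gdr X Y hXY e
      simp only [hG]; omega
    · rw [Gout X (hXY.trans hY) e heA heX, Gout Y hY e heA heY]; omega
  have quot1 : ∀ X ⊆ A ∪ B, ∀ e ∈ A ∪ B, k (insert e X) + G X ≤ k X + G (insert e X) := by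
    intro X hX e he
    by_cases heX : e ∈ X
    · rw [insert_eq_of_mem heX]
    by_cases heA : e ∈ A
    · by_cases heB : e ∈ B
      · rw [Gin X e heA]
        have h1 := kdr (X ∩ (A ∩ B)) X inter_subset_left e
        have h2 := hcommon (X ∩ (A ∩ B)) inter_subset_right
        have h3 := hcommon (insert e (X ∩ (A ∩ B)))
          (insert_subset ⟨heA, heB⟩ inter_subset_right)
        have h4 := gdr (X ∩ A) (X ∩ (A ∩ B) ∪ (A \ B)) (by
          intro x hx
          by_cases hxB : x ∈ B
          · exact Or.inl ⟨hx.1, hx.2, hxB⟩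
          · exact Or.inr ⟨hx.2, hxB⟩) e
        have h5 : g (X ∩ A) = g X := by
          have := M.eRk_inter_ground X; rw [hg, hg] at this; exact_mod_cast this
        have h6 : g (insert e (X ∩ A)) = g (insert e X) := by
          have := M.eRk_inter_ground (insert e X)
          rw [insert_inter_of_mem heA, hg, hg] at this; exact_mod_cast this
        rw [insert_union] at h3
        simp only [hG]
        omega
      · rw [knot X e heB]
        have := Gmono1 X hX e he
        omega
    · rw [Gout X hX e heA heX]
      have := kunit X e
      omega
  have quot : ∀ X Y, X ⊆ Y → Y ⊆ A ∪ B → k Y + G X ≤ k X + G Y := by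
    intro X Y hXY hY
    have key : ∀ K, K.Finite → K ⊆ A ∪ B → k (X ∪ K) + G X ≤ k X + G (X ∪ K) := by
      intro K hK
      induction K, hK using Set.Finite.induction_on with
      | empty => simp
      | @insert e K he hfin ih =>
        intro hK
        rw [insert_subset_iff] at hK
        rw [union_insert]
        have := ih hK.2
        have := quot1 (X ∪ K) (union_subset (hXY.trans hY) hK.2) e hK.1
        omega
    have := key Y (hE.subset hY) hY
    rwa [union_eq_self_of_subset_left hXY] at this
  obtain ⟨L, hLE, hL⟩ := exists_matroid_of_rank hE (fun X ↦ min (G X) (k X + g (A \ B)))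
    (by
      have : g ∅ = 0 := by have := M.eRk_empty; rw [hg] at this; exact_mod_cast this
      simp [hG, this])
    (fun X hX e he ↦ by
      have := Gmono1 X hX e he
      have := kmono X (insert e X) (subset_insert _ _)
      omega)
    (fun X hX e he ↦ by
      have := Gunit1 X hX e he
      have := kunit X e
      omega)
    (fun X Y hXY hY e he ↦ by
      have h1 := Gdr X Y hXY hY e he
      have h2 := kdr X Y hXY e
      have h3 := quot X Y hXY hY
      have h4 := quot1 X (hXY.trans hY) e he
      have h5 := quot1 Y hY e he
      have h6 := kmono X (insert e X) (subset_insert _ _)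
      have h7 := Gmono1 X (hXY.trans hY) e he
      omega)
  have hLs : IsFreeSplice L M N := by
    rw [isFreeSplice_iff]
    refine ⟨hM, hN, h, hLE, fun X hX ↦ ?_⟩
    rw [hL X hX, hg, hk, ← hA, ← hB, hg, ← ((hE.subset hX).subset sdiff_subset).cast_ncard_eq]
    rfl
  refine ⟨L, hLs, fun L' hL' ↦ ?_⟩
  rw [isFreeSplice_iff] at hLs hL'
  obtain ⟨-, -, -, h1, h2⟩ := hLs
  obtain ⟨-, -, -, h3, h4⟩ := hL'
  refine ext_indep (h3.trans h1.symm) fun I hI ↦ ?_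
  rw [h3] at hI
  rw [indep_iff_eRk_eq_encard_of_finite (hE.subset hI),
    indep_iff_eRk_eq_encard_of_finite (hE.subset hI), h2 I hI, h4 I hI]


/-! ### Free separators and the class generated by free splice -/

/-- `(A, B)` is a free separator of `L`: `A ∪ B` is the ground set, and `L` is the free splice
of `L | A` and the contraction of `L` to `B`. -/
def IsFreeSeparator (L : Matroid α) (A B : Set α) : Prop :=
  A ∪ B = L.E ∧ IsFreeSplice L (L.restrict A) (L.contractTo B)

/-- A free separator `(A, B)` is nontrivial if `A - B` and `B - A` are nonempty; a matroid is
reducible if it has a nontrivial free separator, and irreducible otherwise. -/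
def SpliceIrreducible (L : Matroid α) : Prop :=
  ¬ ∃ A B : Set α, IsFreeSeparator L A B ∧ (A \ B).Nonempty ∧ (B \ A).Nonempty

/-- The class of matroids obtained from loops and isthmuses (one-element matroids of rank `0`
and `1`) by repeatedly taking free splices of matched matroids. -/
inductive SpliceGenerated : Matroid α → Prop
  | loop (e : α) : SpliceGenerated (loopyOn {e})
  | isthmus (e : α) : SpliceGenerated (freeOn {e})
  | splice {L M N : Matroid α} (hM : SpliceGenerated M) (hN : SpliceGenerated N)
      (hL : IsFreeSplice L M N) : SpliceGenerated L

/-! ### Transversal matroids -/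

/-- `X` is a partial transversal of the family `A`: one can choose distinct indices for the
elements of `X` such that each element is in the member of the family with its index. -/
def IsPartialTransversal {ι : Type*} (A : ι → Set α) (X : Set α) : Prop :=
  ∃ φ : X → ι, Function.Injective φ ∧ ∀ x : X, (x : α) ∈ A (φ x)

theorem isPartialTransversal_iff {ι : Type*} [Nonempty ι] {A : ι → Set α} {X : Set α} :
    IsPartialTransversal A X ↔ ∃ φ : α → ι, InjOn φ X ∧ ∀ x ∈ X, x ∈ A (φ x) := by
  classical
  constructor
  · rintro ⟨φ, hφ, h⟩
    refine ⟨fun x ↦ if hx : x ∈ X then φ ⟨x, hx⟩ else Classical.arbitrary ι, ?_, ?_⟩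
    · intro x hx y hy hxy
      simp only [hx, hy, dite_true] at hxy
      exact congrArg Subtype.val (hφ hxy)
    · intro x hx
      simp only [hx, dite_true]
      exact h ⟨x, hx⟩
  · rintro ⟨φ, hφ, h⟩
    exact ⟨fun x ↦ φ x, fun x y hxy ↦ Subtype.ext (hφ x.2 y.2 hxy), fun x ↦ h x x.2⟩

theorem IsPartialTransversal.subset {ι : Type*} {A : ι → Set α} {X Y : Set α}
    (hY : IsPartialTransversal A Y) (hXY : X ⊆ Y) : IsPartialTransversal A X := by
  obtain ⟨φ, hφ, h⟩ := hY
  refine ⟨fun x ↦ φ ⟨x, hXY x.2⟩, fun x y hxy ↦ ?_, fun x ↦ h ⟨x, hXY x.2⟩⟩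
  have := congrArg Subtype.val (hφ hxy)
  exact Subtype.ext this

theorem IsPartialTransversal.augment {ι : Type*} {A : ι → Set α} {I J : Set α}
    (hI : IsPartialTransversal A I) (hJ : IsPartialTransversal A J) (hfI : I.Finite)
    (hfJ : J.Finite) (hlt : I.ncard < J.ncard) :
    ∃ e ∈ J, e ∉ I ∧ IsPartialTransversal A (insert e I) := by
  classical
  have hne : Nonempty ι := by
    obtain ⟨φ, -⟩ := hJ
    obtain ⟨x, hx⟩ := (ncard_pos hfJ).1 (by omega)
    exact ⟨φ ⟨x, hx⟩⟩
  rw [isPartialTransversal_iff] at hI hJ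
  obtain ⟨ψ, hψ, hψA⟩ := hJ
  obtain ⟨φ, hφ, hφA⟩ := hI
  induction hm : I.ncard - {x ∈ I | φ x = ψ x}.ncard using Nat.strong_induction_on
    generalizing φ with
  | _ m ih =>
  have hcard : (φ '' I).ncard < (ψ '' J).ncard := by
    rwa [hφ.ncard_image, hψ.ncard_image]
  obtain ⟨j, ⟨x, hxJ, rfl⟩, hj⟩ := exists_mem_notMem_of_ncard_lt_ncard hcard (hfI.image _)
  by_cases hxI : x ∈ I
  · have hneq : φ x ≠ ψ x := fun h ↦ hj ⟨x, hxI, h⟩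
    have hsub : {y ∈ I | φ y = ψ y} ⊂ {y ∈ I | Function.update φ x (ψ x) y = ψ y} := by
      rw [ssubset_iff_of_subset]
      · exact ⟨x, ⟨hxI, by simp⟩, fun h ↦ hneq h.2⟩
      · rintro y ⟨hy, h⟩
        refine ⟨hy, ?_⟩
        by_cases hyx : y = x
        · subst hyx; simp
        · simp [hyx, h]
    have h1 := ncard_lt_ncard hsub (hfI.subset (sep_subset _ _))
    have h2 := ncard_le_ncard (sep_subset I (fun y ↦ Function.update φ x (ψ x) y = ψ y)) hfI
    refine ih _ ?_ (Function.update φ x (ψ x)) ?_ ?_ rfl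
    · change {y ∈ I | Function.update φ x (ψ x) y = ψ y}.ncard ≤ I.ncard at h2
      omega
    · intro y hy z hz hyz
      by_cases hyx : y = x <;> by_cases hzx : z = x
      · rw [hyx, hzx]
      · subst hyx
        simp only [Function.update_self, Function.update_of_ne hzx] at hyz
        exact (hj ⟨z, hz, hyz.symm⟩).elim
      · subst hzx
        simp only [Function.update_self, Function.update_of_ne hyx] at hyz
        exact (hj ⟨y, hy, hyz⟩).elim
      · simp only [Function.update_of_ne hzx, Function.update_of_ne hyx] at hyz
        exact hφ hy hz hyz
    · intro y hy
      by_cases hyx : y = x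
      · subst hyx; simpa using hψA y hxJ
      · simpa [hyx] using hφA y hy
  · refine ⟨x, hxJ, hxI, isPartialTransversal_iff.2 ⟨Function.update φ x (ψ x), ?_, ?_⟩⟩
    · have hupd : ∀ y ∈ I, Function.update φ x (ψ x) y = φ y := fun y hy ↦
        Function.update_of_ne (by rintro rfl; exact hxI hy) _ _
      rintro y (rfl | hy) z (rfl | hz) hyz
      · rfl
      · rw [Function.update_self, hupd z hz] at hyz
        exact (hj ⟨z, hz, hyz.symm⟩).elim
      · rw [Function.update_self, hupd y hy] at hyz
        exact (hj ⟨y, hy, hyz⟩).elim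
      · rw [hupd y hy, hupd z hz] at hyz
        exact hφ hy hz hyz
    · rintro y (rfl | hy)
      · simpa using hψA y hxJ
      · rw [Function.update_of_ne (by rintro rfl; exact hxI hy)]
        exact hφA y hy

/-- The transversal matroid on the finite set `E` presented by the family `A`: its independent
sets are the partial transversals of `A` that are contained in `E`. Geometrically, the indices are
the vertices of a simplex and `x ∈ E` is placed freely on the face `{i | x ∈ A i}`. -/
def transversalMatroid {ι : Type*} (A : ι → Set α) (E : Set α) (hE : E.Finite) : Matroid α :=
  (IndepMatroid.ofFinite hE (fun I ↦ I ⊆ E ∧ IsPartialTransversal A I)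
    ⟨empty_subset _, fun x ↦ x.2.elim, fun x ↦ x.2.elim, fun x ↦ x.2.elim⟩
    (fun _ _ hJ hIJ ↦ ⟨hIJ.trans hJ.1, hJ.2.subset hIJ⟩)
    (fun I J hI hJ hlt ↦ by
      obtain ⟨e, heJ, heI, h⟩ := hI.2.augment hJ.2 (hE.subset hI.1) (hE.subset hJ.1) hlt
      exact ⟨e, heJ, heI, insert_subset (hJ.1 heJ) hI.1, h⟩)
    (fun _ h ↦ h.1)).matroid

@[simp] theorem transversalMatroid_ground {ι : Type*} (A : ι → Set α) (E : Set α)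
    (hE : E.Finite) : (transversalMatroid A E hE).E = E := rfl

@[simp] theorem transversalMatroid_indep_iff {ι : Type*} {A : ι → Set α} {E : Set α}
    {hE : E.Finite} {I : Set α} :
    (transversalMatroid A E hE).Indep I ↔ I ⊆ E ∧ IsPartialTransversal A I := Iff.rfl

/-- `M` is a fundamental transversal matroid: it is a transversal matroid with a presentation
(a representation on a simplex) such that each vertex `i` of the simplex has an element `v` of `M`
placed at it, that is, `v` is in the member with index `i` and in no other member. -/
def IsFundamentalTransversal (M : Matroid α) : Prop :=
  ∃ (hE : M.E.Finite) (r : ℕ) (A : Fin r → Set α),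
    M = transversalMatroid A M.E hE ∧ ∀ i, ∃ v ∈ M.E, ∀ j, v ∈ A j ↔ j = i

/-- The bicircular matroid with one element `s(i, i)` at each vertex `i` of the simplex with `n`
vertices and one element `s(i, j)` freely on each edge `{i, j}` of the simplex. -/
def bicircularSimplex (n : ℕ) : Matroid (Sym2 (Fin n)) :=
  transversalMatroid (fun v : Fin n ↦ {e | v ∈ e}) univ finite_univ

/-- The restriction of the above matroid to the elements that are freely on the edges of the
simplex. -/
def bicircularSimplexEdges (n : ℕ) : Matroid (Sym2 (Fin n)) :=
  (bicircularSimplex n).restrict {e | ¬ e.IsDiag}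

end Matroid

namespace Matroid

variable {α : Type*}

/-! ### Free separators -/

/-! A free splice determines its factors: `M` is the restriction of `L` to `A`, and `N` is the
contraction of `L` to `B`. So free splices correspond to free separators of `L`, and these are
described by one rank identity, `r(X) = min (r(X ∩ A) + |X - A|) (r(X ∪ (A - B)))`
(`isFreeSeparator_iff`). Under the rank formula of the dual the two terms of the minimum trade
places when `A` and `B` do, which gives closure under duality.

For fundamental transversal matroids, let `v` be the element at vertex `i` and let `b` be another
element on a face that contains `i`. Every circuit through `b` spans `v`, so `(E - b, E - v)` is a
free separator (`isFreeSeparator_of_pair`). Deleting `b` keeps all vertex elements, and contracting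
`v` removes the vertex `i`, so both factors are smaller and again fundamental. If no such `b`
exists, every element is a loop or an isthmus (`spliceGenerated_uniqueBaseOn`).

For the failure on minors, an irreducible matroid in the class has only one element
(`exists_ground_eq_singleton`). The edge matroid is irreducible for `n ≥ 5`. Given `a ∈ A - B` and
`b ∈ B - A`, take a 4-cycle that has `b` as a chord and misses some vertex of `a`. The cycle with
`b` has rank 4, while both terms of the minimum are at least 5. -/

theorem ext_eRk_of_finite {M N : Matroid α} (hfin : M.E.Finite) (hE : M.E = N.E)
    (h : ∀ X ⊆ M.E, M.eRk X = N.eRk X) : M = N := by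
  refine ext_indep hE fun I hI ↦ ?_
  rw [indep_iff_eRk_eq_encard_of_finite (hfin.subset hI),
    indep_iff_eRk_eq_encard_of_finite (hfin.subset hI), h I hI]

theorem eRk_ne_top_of_finite_ground {M : Matroid α} (hfin : M.E.Finite) (X : Set α) :
    M.eRk X ≠ ⊤ := by
  rw [← eRk_inter_ground]
  exact ne_top_of_le_ne_top (encard_ne_top_iff.2 (hfin.subset inter_subset_right))
    (M.eRk_le_encard _)

theorem contractTo_ground {M : Matroid α} {B : Set α} (hB : B ⊆ M.E) :
    (M.contractTo B).E = B := by
  rw [contractTo, contract_ground, sdiff_sdiff_cancel_left hB]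

/-- Restriction and contraction commute: both sides are the minor of `L` on `A ∩ B` in which `A - B`
is contracted. Hence matching need not be checked for free separators. -/
theorem matched_restrict_contractTo {L : Matroid α} {A B : Set α} (h : A ∪ B = L.E) :
    Matched (L.restrict A) (L.contractTo B) := by
  have hB : B ⊆ L.E := h ▸ subset_union_right
  have h1 : L.E \ B = A \ B := by rw [← h, union_sdiff_right]
  rw [Matched, contractTo_ground hB, contractTo, restrict_ground_eq, sdiff_self_inter, contractTo,
    h1, restrict_contract_eq_contract_restrict _ sdiff_subset, sdiff_sdiff_right_self]

/-- The contraction to `B` is `L / (A - B)`, so its rank at `X` plus `r(A - B)` is `r(X ∪ (A - B))`.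
All conditions of the free splice then reduce to one identity in the rank function of `L`. -/
theorem isFreeSeparator_iff {L : Matroid α} (hfin : L.E.Finite) {A B : Set α}
    (h : A ∪ B = L.E) :
    IsFreeSeparator L A B ↔ ∀ X ⊆ L.E,
      L.eRk X = min (L.eRk (X ∩ A) + (X \ A).encard) (L.eRk (X ∪ (A \ B))) := by
  have hA : A ⊆ L.E := h ▸ subset_union_left
  have hB : B ⊆ L.E := h ▸ subset_union_right
  have h1 : L.E \ B = A \ B := by rw [← h, union_sdiff_right]
  rw [IsFreeSeparator, isFreeSplice_iff, contractTo_ground hB, restrict_ground_eq, h]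
  simp only [hfin.subset hA, hfin.subset hB, matched_restrict_contractTo h, true_and]
  refine forall₂_congr fun X hX ↦ ?_
  rw [restrict_eRk_eq', restrict_eRk_eq _ sdiff_subset, contractTo, h1, contract_eRk_add]

/-- For `X ⊆ A` the first term of the minimum is `r_M(X)`. By matching, the second is `r_M((X ∩ B) ∪
(A - B))`, which is no smaller because that set contains `X`. -/
theorem IsFreeSplice.restrict_eq {L M N : Matroid α} (h : IsFreeSplice L M N) :
    L.restrict M.E = M := by
  obtain ⟨hM, hN, hmat, hE, hr⟩ := isFreeSplice_iff.1 h
  refine ext_eRk_of_finite hM rfl fun X hX ↦ ?_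
  change X ⊆ M.E at hX
  rw [restrict_eRk_eq _ hX, hr X (hX.trans subset_union_left), sdiff_eq_empty.2 hX, encard_empty,
    add_zero, min_eq_left]
  have h1 : N.eRk X + M.eRk (M.E \ N.E) = M.eRk (X ∩ N.E ∪ (M.E \ N.E)) := by
    have h2 : M.contract (M.E \ N.E) = N.restrict (M.E ∩ N.E) := by
      rwa [Matched, contractTo, sdiff_self_inter] at hmat
    rw [← contract_eRk_add, h2, restrict_eRk_eq _ (inter_subset_inter_left _ hX),
      eRk_inter_ground]
  rw [h1]
  refine M.eRk_mono fun x hx ↦ ?_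
  by_cases hxN : x ∈ N.E
  · exact Or.inl ⟨hx, hxN⟩
  · exact Or.inr ⟨hX hx, hxN⟩

/-- For `X ⊆ B`, evaluate the rank of `L` at `X ∪ (A - B)` and cancel the finite number `r_M(A -
B)`. By matching, the terms left are `r_N(X ∩ A) + |X - A|` and `r_N(X)`, and the second is the
minimum. -/
theorem IsFreeSplice.contractTo_eq {L M N : Matroid α} (h : IsFreeSplice L M N) :
    L.contractTo N.E = N := by
  obtain ⟨hM, hN, hmat, hE, hr⟩ := isFreeSplice_iff.1 h
  have hNL : N.E ⊆ L.E := hE ▸ subset_union_right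
  have hg := contractTo_ground hNL
  refine ext_eRk_of_finite (by rwa [hg]) hg fun X hX ↦ ?_
  rw [hg] at hX
  have h1 : L.E \ N.E = M.E \ N.E := by rw [hE, union_sdiff_right]
  have h2 : M.contract (M.E \ N.E) = N.restrict (M.E ∩ N.E) := by
    rwa [Matched, contractTo, sdiff_self_inter] at hmat
  have h3 := L.contract_eRk_add X (M.E \ N.E)
  have h4 : L.eRk (M.E \ N.E) = M.eRk (M.E \ N.E) := by
    rw [← restrict_eRk_eq L sdiff_subset, h.restrict_eq]
  have h5 : M.eRk (X ∪ M.E \ N.E) = N.eRk (X ∩ M.E) + M.eRk (M.E \ N.E) := by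
    rw [← contract_eRk_add, h2, restrict_eRk_eq', ← inter_assoc,
      inter_right_comm, inter_eq_self_of_subset_left hX]
  have h6 : (X ∪ M.E \ N.E) \ M.E = X \ M.E := by
    rw [union_sdiff_distrib, sdiff_eq_empty.2 (sdiff_subset (s := M.E)), union_empty]
  have h7 : N.eRk (X ∪ M.E \ N.E) = N.eRk X := by
    rw [← eRk_inter_ground, union_inter_distrib_right, sdiff_inter_self, union_empty,
      inter_eq_self_of_subset_left hX]
  have h8 : N.eRk X ≤ N.eRk (X ∩ M.E) + (X \ M.E).encard :=
    (N.eRk_le_eRk_inter_add_eRk_sdiff X M.E).trans (by gcongr; exact N.eRk_le_encard _)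
  rw [h4, hr _ (union_subset (hX.trans subset_union_right) (sdiff_subset.trans subset_union_left)),
    h5, h6, h7, add_right_comm, min_eq_right (by gcongr)] at h3
  rw [contractTo, h1]
  exact (ENat.add_left_injective_of_ne_top (eRk_ne_top_of_finite_ground hM _)) h3

theorem IsFreeSplice.ground_eq {L M N : Matroid α} (h : IsFreeSplice L M N) :
    M.E ∪ N.E = L.E := (isFreeSplice_iff.1 h).2.2.2.1.symm

theorem IsFreeSplice.finite {L M N : Matroid α} (h : IsFreeSplice L M N) : L.E.Finite :=
  h.ground_eq ▸ h.finite_left.union h.finite_right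

theorem IsFreeSplice.isFreeSeparator {L M N : Matroid α} (h : IsFreeSplice L M N) :
    IsFreeSeparator L M.E N.E :=
  ⟨h.ground_eq, by rwa [h.restrict_eq, h.contractTo_eq]⟩

/-! ### Duality -/

theorem IsFreeSeparator.finite {L : Matroid α} {A B : Set α} (h : IsFreeSeparator L A B) :
    L.E.Finite := h.2.finite

/-- The rank identity of `L` at `E - X` is the one needed for the dual at `X`: complementation turns
`X ∩ B` into `(E - X) ∪ (A - B)` and `X ∪ (B - A)` into `(E - X) ∩ A`. -/
theorem IsFreeSeparator.dual {L : Matroid α} {A B : Set α} (h : IsFreeSeparator L A B) :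
    IsFreeSeparator L✶ B A := by
  have hfin := h.finite
  have hAB := h.1
  have hr := (isFreeSeparator_iff hfin hAB).1 h
  refine (isFreeSeparator_iff (L := L✶) hfin (by rw [union_comm]; exact hAB)).2 fun X hX ↦ ?_
  change X ⊆ L.E at hX
  have hA : A ⊆ L.E := hAB ▸ subset_union_left
  have hB : B ⊆ L.E := hAB ▸ subset_union_right
  have e0 := L.eRk_dual_add_eRank X hX
  have e1 := L.eRk_dual_add_eRank (X ∩ B) (inter_subset_left.trans hX)
  have e2 := L.eRk_dual_add_eRank (X ∪ (B \ A)) (union_subset hX (sdiff_subset.trans hB))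
  have hmem : ∀ x, x ∈ L.E ↔ x ∈ A ∨ x ∈ B := fun x ↦ by rw [← hAB, mem_union]
  have s1 : L.E \ (X ∩ B) = L.E \ X ∪ (A \ B) := by
    ext x; have := hmem x; simp only [mem_union, mem_sdiff, mem_inter_iff]; tauto
  have s2 : L.E \ (X ∪ (B \ A)) = (L.E \ X) ∩ A := by
    ext x; have := hmem x; simp only [mem_union, mem_sdiff, mem_inter_iff]; tauto
  -- This form of the union is disjoint, so its cardinality is a sum.
  have s3 : X ∪ (B \ A) = X ∪ ((L.E \ X) \ A) := by
    ext x; have := hmem x; simp only [mem_union, mem_sdiff]; tauto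
  have c1 : (X ∩ B).encard + (X \ B).encard = X.encard := by
    rw [add_comm, encard_sdiff_add_encard_inter]
  have c2 : (X ∪ (B \ A)).encard = X.encard + ((L.E \ X) \ A).encard := by
    rw [s3, encard_union_eq (disjoint_sdiff_right.mono_right sdiff_subset)]
  rw [s1] at e1
  rw [s2, c2] at e2
  have e3 := hr (L.E \ X) sdiff_subset
  rw [← L.eRk_ground] at e0 e1 e2
  -- Every quantity is finite; what remains is linear arithmetic with minima in `ℕ`.
  lift L✶.eRk X to ℕ using eRk_ne_top_of_finite_ground (M := L✶) hfin _ with d0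
  lift L✶.eRk (X ∩ B) to ℕ using eRk_ne_top_of_finite_ground (M := L✶) hfin _ with d1
  lift L✶.eRk (X ∪ (B \ A)) to ℕ using eRk_ne_top_of_finite_ground (M := L✶) hfin _ with d2
  lift L.eRk L.E to ℕ using eRk_ne_top_of_finite_ground hfin _ with r
  lift L.eRk (L.E \ X) to ℕ using eRk_ne_top_of_finite_ground hfin _ with r0
  lift L.eRk (L.E \ X ∪ A \ B) to ℕ using eRk_ne_top_of_finite_ground hfin _ with r1
  lift L.eRk (L.E \ X ∩ A) to ℕ using eRk_ne_top_of_finite_ground hfin _ with r2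
  lift X.encard to ℕ using encard_ne_top_iff.2 (hfin.subset hX) with c
  lift (X \ B).encard to ℕ using encard_ne_top_iff.2 ((hfin.subset hX).sdiff) with c3
  lift (X ∩ B).encard to ℕ using encard_ne_top_iff.2
    (hfin.subset (inter_subset_left.trans hX)) with c4
  lift ((L.E \ X) \ A).encard to ℕ using encard_ne_top_iff.2 (hfin.sdiff.sdiff) with c5
  have hmin : ∀ a b : ℕ, min (a : ℕ∞) b = (min a b : ℕ) := fun a b ↦ (Nat.mono_cast.map_min).symm
  norm_cast at *
  rw [hmin, Nat.cast_inj] at *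
  omega

theorem IsFreeSplice.dual {L M N : Matroid α} (h : IsFreeSplice L M N) :
    IsFreeSplice L✶ N✶ M✶ := by
  have h1 := h.isFreeSeparator.dual.2
  have hE := h.ground_eq
  have e1 : L✶.restrict N.E = N✶ := by
    have := dual_contract L (L.E \ N.E)
    rw [← contractTo, h.contractTo_eq, ← dual_ground, ← restrict_compl, dual_ground,
      sdiff_sdiff_cancel_left (hE ▸ subset_union_right)] at this
    exact this.symm
  have e2 : L✶.contractTo M.E = M✶ := by
    have := dual_delete L (L.E \ M.E)
    rw [← restrict_compl, sdiff_sdiff_cancel_left (hE ▸ subset_union_left), h.restrict_eq] at this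
    exact this.symm
  rwa [e1, e2] at h1

theorem SpliceGenerated.dual {M : Matroid α} (h : M.SpliceGenerated) :
    M✶.SpliceGenerated := by
  induction h with
  | loop e => rw [loopyOn_dual_eq]; exact .isthmus e
  | isthmus e => rw [freeOn_dual_eq]; exact .loop e
  | splice _ _ hL hM hN => exact .splice hN hM hL.dual

/-! ### Irreducible matroids in the class -/

/-- A splice with `A ⊆ B` or `B ⊆ A` is equal to one of its factors, so induction applies to that
factor; any other splice exhibits a nontrivial free separator. -/
theorem SpliceGenerated.exists_ground_eq_singleton {L : Matroid α} (h : L.SpliceGenerated)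
    (hL : L.SpliceIrreducible) : ∃ e, L.E = {e} := by
  induction h with
  | loop e => exact ⟨e, rfl⟩
  | isthmus e => exact ⟨e, rfl⟩
  | @splice L M N _ _ h hM hN =>
    by_cases h1 : (M.E \ N.E).Nonempty
    · by_cases h2 : (N.E \ M.E).Nonempty
      · exact (hL ⟨_, _, h.isFreeSeparator, h1, h2⟩).elim
      · rw [not_nonempty_iff_eq_empty, sdiff_eq_empty] at h2
        have : M = L := by
          have hE := h.ground_eq
          rw [union_eq_self_of_subset_right h2] at hE
          rw [← h.restrict_eq, hE, L.restrict_ground_eq_self]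
        exact this ▸ hM (this ▸ hL)
    · rw [not_nonempty_iff_eq_empty, sdiff_eq_empty] at h1
      have : N = L := by
        have hE := h.ground_eq
        rw [union_eq_self_of_subset_left h1] at hE
        rw [← h.contractTo_eq, hE, contractTo, sdiff_self, contract_empty]
      exact this ▸ hN (this ▸ hL)

/-! ### Fundamental transversal matroids -/

/-- If every circuit containing `b` spans `a`, then `(E - b, E - a)` is a free separator. -/
theorem isFreeSeparator_of_pair {L : Matroid α} (hfin : L.E.Finite) {a b : α} (ha : a ∈ L.E)
    (hab : a ≠ b) (h : ∀ I, a ∉ I → b ∉ I → L.Indep (insert a I) → L.Indep (insert b I)) :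
    IsFreeSeparator L (L.E \ {b}) (L.E \ {a}) := by
  have hU : (L.E \ {b}) ∪ (L.E \ {a}) = L.E := by
    ext x
    by_cases hx : x = a
    · simp [hx, ha, hab]
    · simp only [mem_union, mem_sdiff, mem_singleton_iff]; tauto
  have hD : (L.E \ {b}) \ (L.E \ {a}) = {a} := by
    ext x
    by_cases hx : x = a
    · simp [hx, ha, hab]
    · simp only [mem_sdiff, mem_singleton_iff]; tauto
  refine (isFreeSeparator_iff hfin hU).2 fun X hX ↦ ?_
  rw [hD, union_singleton]
  have hXb : X ∩ (L.E \ {b}) = X \ {b} := by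
    rw [← inter_sdiff_assoc, inter_eq_self_of_subset_left hX]
  have hle : L.eRk X ≤ L.eRk (insert a X) := L.eRk_mono (subset_insert _ _)
  -- Only sets that contain `b` matter. For these, let `I` be a basis of `X - b`: either `I + b` is
  -- independent and the first term is attained, or `I` spans `a` and the second term is `r(X)`.
  by_cases hbX : b ∈ X
  · have hXd : X \ (L.E \ {b}) = {b} := by
      ext x
      have := @hX x
      by_cases hx : x = b
      · simp [hx, hbX]
      · simp only [mem_sdiff, mem_singleton_iff]; tauto
    rw [hXb, hXd, encard_singleton]
    have hins : insert b (X \ {b}) = X := insert_sdiff_self_of_mem hbX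
    have hle1 : L.eRk X ≤ L.eRk (X \ {b}) + 1 := by
      conv_lhs => rw [← hins]
      exact L.eRk_insert_le_add_one b _
    obtain ⟨I, hI⟩ := L.exists_isBasis (X \ {b}) (sdiff_subset.trans hX)
    have hbI : b ∉ I := fun hh ↦ (hI.subset hh).2 rfl
    by_cases hIb : L.Indep (insert b I)
    · have h1 : L.eRk (X \ {b}) + 1 ≤ L.eRk X := by
        rw [hI.eRk_eq_encard, ← encard_insert_of_notMem hbI]
        exact hIb.encard_le_eRk_of_subset
          (insert_subset hbX (hI.subset.trans sdiff_subset))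
      exact le_antisymm (le_min hle1 hle) ((min_le_left _ _).trans h1)
    · refine le_antisymm (le_min hle1 hle) ((min_le_right _ _).trans ?_)
      have hIa : a ∈ L.closure I := by
        by_cases haI : a ∈ I
        · exact L.subset_closure I hI.indep.subset_ground haI
        · by_contra hcl
          refine hIb (h I haI hbI ?_)
          exact (hI.indep.notMem_closure_iff_of_notMem haI ha).1 hcl
      have hcl : a ∈ L.closure X := L.closure_subset_closure (hI.subset.trans sdiff_subset) hIa
      rw [← L.eRk_closure_eq X]
      exact L.eRk_mono (insert_subset hcl (L.subset_closure X hX))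
  · have hXd : X \ (L.E \ {b}) = ∅ := by
      rw [sdiff_eq_empty]
      exact subset_sdiff_singleton hX hbX
    rw [hXb, hXd, encard_empty, add_zero, sdiff_singleton_eq_self hbX, min_eq_left hle]

/-- The inductive step for building matroids in the class: the factors of the separator `(E - b, E -
a)` are `L \ b` and `L / a`, each with one element fewer. -/
theorem SpliceGenerated.of_pair {L : Matroid α} (hfin : L.E.Finite) {a b : α} (ha : a ∈ L.E)
    (hab : a ≠ b)
    (h : ∀ I, a ∉ I → b ∉ I → L.Indep (insert a I) → L.Indep (insert b I))
    (hdel : (L.restrict (L.E \ {b})).SpliceGenerated)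
    (hcon : (L.contract {a}).SpliceGenerated) : L.SpliceGenerated := by
  refine .splice hdel ?_ (isFreeSeparator_of_pair hfin ha hab h).2
  rwa [contractTo, sdiff_sdiff_cancel_left (singleton_subset_iff.2 ha)]

theorem spliceGenerated_uniqueBaseOn {I E : Set α} (hE : E.Finite) (hne : E.Nonempty)
    (hI : I ⊆ E) : (uniqueBaseOn I E).SpliceGenerated := by
  induction hn : E.ncard using Nat.strong_induction_on generalizing I E with
  | _ n ih =>
  obtain ⟨e, rfl⟩ | hnt := hne.exists_eq_singleton_or_nontrivial
  · obtain rfl | rfl := subset_singleton_iff_eq.1 hI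
    · rw [uniqueBaseOn_empty]; exact .loop e
    · rw [uniqueBaseOn_self]; exact .isthmus e
  have hdel : ∀ x ∈ E, ((uniqueBaseOn I E).restrict (E \ {x})).SpliceGenerated := by
    intro x hx
    rw [uniqueBaseOn_restrict hI]
    refine ih _ ?_ hE.sdiff ?_ inter_subset_right rfl
    · rw [← hn]; exact ncard_sdiff_singleton_lt_of_mem hx hE
    · obtain ⟨y, hy, hyx⟩ := hnt.exists_ne x
      exact ⟨y, hy, hyx⟩
  have hcon : ∀ x ∈ E, ((uniqueBaseOn I E).contract {x}).SpliceGenerated := by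
    intro x hx
    -- Each element is a loop or an isthmus, for which contraction and deletion agree.
    suffices (uniqueBaseOn I E).contract {x} = (uniqueBaseOn I E).restrict (E \ {x}) by
      rw [this]; exact hdel x hx
    change _ = (uniqueBaseOn I E).restrict ((uniqueBaseOn I E).E \ {x})
    rw [restrict_compl]
    by_cases hxI : x ∈ I
    · refine contract_eq_delete_of_subset_coloops (singleton_subset_iff.2 ?_)
      rw [← isColoop_iff_mem_coloops, ← dual_isLoop_iff_isColoop, uniqueBaseOn_dual_eq,
        uniqueBaseOn_isLoop_iff]
      exact ⟨hx, fun hh ↦ hh.2 hxI⟩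
    · refine contract_eq_delete_of_subset_loops (singleton_subset_iff.2 ?_)
      exact uniqueBaseOn_isLoop_iff.2 ⟨hx, hxI⟩
  -- Any two elements can be ordered so that the exchange condition holds; only the pair of an
  -- isthmus `a` and a loop `b` must be avoided.
  obtain ⟨a, ha, b, hb, hab, h⟩ : ∃ a ∈ E, ∃ b ∈ E, a ≠ b ∧ (a ∈ I → b ∈ I) := by
    obtain ⟨a, ha, b, hb, hab⟩ := hnt
    by_cases hbI : b ∈ I
    · exact ⟨a, ha, b, hb, hab, fun _ ↦ hbI⟩
    · exact ⟨b, hb, a, ha, hab.symm, fun hh ↦ (hbI hh).elim⟩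
  refine .of_pair hE ha hab (fun J _ _ hJ ↦ ?_) (hdel b hb) (hcon a ha)
  rw [uniqueBaseOn_indep_iff hI, insert_subset_iff] at hJ ⊢
  exact ⟨h hJ.1, hJ.2⟩

/-! ### Minors of transversal matroids, and induction over vertex elements -/

theorem transversalMatroid_restrict {ι : Type*} (A : ι → Set α) {E R : Set α} (hE : E.Finite)
    (hR : R ⊆ E) :
    (transversalMatroid A E hE).restrict R = transversalMatroid A R (hE.subset hR) := by
  refine ext_indep rfl fun I hI ↦ ?_
  rw [restrict_indep_iff, transversalMatroid_indep_iff, transversalMatroid_indep_iff]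
  exact ⟨fun h ↦ ⟨h.2, h.1.2⟩, fun h ↦ ⟨⟨h.1.trans hR, h.2⟩, h.1⟩⟩

/-- A matching given as a map from indices to elements needs no injectivity check, since distinct
elements have distinct preimages. -/
theorem isPartialTransversal_of_section {ι : Type*} {A : ι → Set α} {X : Set α} (f : ι → α)
    (h : ∀ x ∈ X, ∃ i, f i = x ∧ x ∈ A i) : IsPartialTransversal A X := by
  choose φ hφ hφA using fun x : X ↦ h x x.2
  exact ⟨φ, fun x y hxy ↦ Subtype.ext (by rw [← hφ x, ← hφ y, hxy]), hφA⟩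

/-- Adding an element to a partial transversal that is in a member of the family with an index
that is not used. -/
theorem IsPartialTransversal.insert_of_mem {ι : Type*} {A : ι → Set α} {I : Set α} {i : ι}
    {e : α} (hI : IsPartialTransversal (fun j : {j // j ≠ i} ↦ A j) I) (he : e ∈ A i) :
    IsPartialTransversal A (insert e I) := by
  classical
  obtain ⟨φ, hφ, hφA⟩ := hI
  refine ⟨fun x ↦ if hx : (x : α) ∈ I then φ ⟨x, hx⟩ else i, ?_, ?_⟩
  · rintro ⟨x, hx⟩ ⟨y, hy⟩ hxy
    by_cases hxI : x ∈ I <;> by_cases hyI : y ∈ I <;>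
      simp only [hxI, hyI, dite_true, dite_false] at hxy
    · simpa using hφ (Subtype.ext hxy)
    · exact ((φ ⟨x, hxI⟩).2 hxy).elim
    · exact ((φ ⟨y, hyI⟩).2 hxy.symm).elim
    · simp [hx.resolve_right hxI, hy.resolve_right hyI]
  · rintro ⟨x, hx⟩
    by_cases hxI : x ∈ I
    · simpa [hxI] using hφA ⟨x, hxI⟩
    · obtain rfl := hx.resolve_right hxI
      simpa [hxI] using he

/-- An element that is in only one member of the family uses the index of that member. -/
theorem IsPartialTransversal.of_insert {ι : Type*} {A : ι → Set α} {I : Set α} {i : ι} {v : α}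
    (hv : ∀ j, v ∈ A j ↔ j = i) (hvI : v ∉ I) (h : IsPartialTransversal A (insert v I)) :
    IsPartialTransversal (fun j : {j // j ≠ i} ↦ A j) I := by
  obtain ⟨φ, hφ, hφA⟩ := h
  have hφv := (hv _).1 (hφA ⟨v, mem_insert _ _⟩)
  refine ⟨fun x ↦ ⟨φ ⟨x, mem_insert_of_mem _ x.2⟩, fun hx ↦ ?_⟩, fun x y hxy ↦ ?_, fun x ↦ ?_⟩
  · have := hφ (hx.trans hφv.symm)
    simp only [Subtype.mk.injEq] at this
    exact hvI (this ▸ x.2)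
  · have := hφ (congrArg Subtype.val hxy)
    simpa [Subtype.ext_iff] using this
  · exact hφA ⟨x, mem_insert_of_mem _ x.2⟩

/-- The element `v` can be matched only to `i`, so contracting it uses up that index: geometrically,
this is projection from the vertex `i`. -/
theorem transversalMatroid_contract {ι : Type*} (A : ι → Set α) {E : Set α} (hE : E.Finite)
    {i : ι} {v : α} (hvE : v ∈ E) (hv : ∀ j, v ∈ A j ↔ j = i) :
    (transversalMatroid A E hE).contract {v} =
      transversalMatroid (fun j : {j // j ≠ i} ↦ A j) (E \ {v}) hE.sdiff := by
  have hnl : (transversalMatroid A E hE).IsNonloop v := by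
    rw [← indep_singleton, transversalMatroid_indep_iff, ← insert_empty_eq]
    refine ⟨by simpa using hvE, IsPartialTransversal.insert_of_mem (i := i)
      ⟨fun x ↦ x.2.elim, fun x ↦ x.2.elim, fun x ↦ x.2.elim⟩ ((hv i).2 rfl)⟩
  refine ext_indep rfl fun I hI ↦ ?_
  rw [hnl.contractElem_indep_iff, transversalMatroid_indep_iff, transversalMatroid_indep_iff]
  change I ⊆ E \ {v} at hI
  have hvI : v ∉ I := fun hh ↦ (hI hh).2 rfl
  exact ⟨fun h ↦ ⟨hI, h.2.2.of_insert hv hvI⟩,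
    fun h ↦ ⟨hvI, insert_subset hvE (hI.trans sdiff_subset), h.2.insert_of_mem ((hv i).2 rfl)⟩⟩

/-- The index type is arbitrary and varies in the induction, because contraction passes to the
subtype of indices other than `i`. -/
theorem spliceGenerated_transversalMatroid {ι : Type*} (A : ι → Set α) {E : Set α}
    (hE : E.Finite) (hne : E.Nonempty) (v : ι → α) (hvE : ∀ i, v i ∈ E)
    (hv : ∀ i j, v i ∈ A j ↔ j = i) : (transversalMatroid A E hE).SpliceGenerated := by
  induction hn : E.ncard using Nat.strong_induction_on generalizing ι E with
  | _ n ih =>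
  have hinj : ∀ i j, v i = v j → i = j := fun i j hij ↦ by
    rw [← hv j i, ← hij]; exact (hv i i).2 rfl
  by_cases h : ∃ b ∈ E, b ∉ range v ∧ ∃ i, b ∈ A i
  · obtain ⟨b, hb, hbv, i, hbi⟩ := h
    have hab : v i ≠ b := fun hh ↦ hbv ⟨i, hh⟩
    refine .of_pair (L := transversalMatroid A E hE) (a := v i) (b := b) hE (hvE i) hab
      (fun I haI hbI hI ↦ ?_) ?_ ?_
    · rw [transversalMatroid_indep_iff, insert_subset_iff] at hI ⊢
      -- The index `i`, which only `v i` can take, is freed and then given to `b`.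
      exact ⟨⟨hb, hI.1.2⟩, (hI.2.of_insert (hv i) haI).insert_of_mem hbi⟩
    · rw [transversalMatroid_ground, transversalMatroid_restrict A hE sdiff_subset]
      refine ih _ ?_ A hE.sdiff ⟨v i, hvE i, hab⟩ v (fun j ↦ ⟨hvE j, fun hh ↦ hbv ⟨j, hh⟩⟩) hv rfl
      rw [← hn]; exact ncard_sdiff_singleton_lt_of_mem hb hE
    · rw [transversalMatroid_contract A hE (hvE i) (hv i)]
      refine ih _ ?_ _ hE.sdiff ⟨b, hb, hab.symm⟩ (fun j : {j // j ≠ i} ↦ v j)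
        (fun j ↦ ⟨hvE j, fun hh ↦ j.2 (hinj _ _ hh)⟩)
        (fun j k ↦ by rw [hv, Subtype.ext_iff]) rfl
      rw [← hn]; exact ncard_sdiff_singleton_lt_of_mem (hvE i) hE
  -- Now every element other than the `v i` lies in no member of the family, so it is a loop, and
  -- the `v i` form the only basis.
  · push Not at h
    have hr : range v ⊆ E := range_subset_iff.2 hvE
    suffices transversalMatroid A E hE = uniqueBaseOn (range v) E by
      rw [this]; exact spliceGenerated_uniqueBaseOn hE hne hr
    refine ext_indep rfl fun I hI ↦ ?_
    change I ⊆ E at hI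
    rw [transversalMatroid_indep_iff, uniqueBaseOn_indep_iff hr, and_iff_right hI]
    constructor
    · rintro ⟨φ, -, hφ⟩ x hx
      by_contra hxv
      exact h x (hI hx) hxv _ (hφ ⟨x, hx⟩)
    · intro hIv
      refine isPartialTransversal_of_section v fun x hx ↦ ?_
      obtain ⟨i, rfl⟩ := hIv hx
      exact ⟨i, rfl, (hv i i).2 rfl⟩

theorem IsFundamentalTransversal.spliceGenerated {M : Matroid α}
    (h : M.IsFundamentalTransversal) (hne : M.E.Nonempty) : M.SpliceGenerated := by
  obtain ⟨hE, r, A, hM, hA⟩ := h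
  choose v hvE hv using hA
  rw [hM]
  exact spliceGenerated_transversalMatroid A hE hne v hvE hv

/-! ### Bicircular matroids of simplices -/

theorem spliceGenerated_bicircularSimplex {n : ℕ} (hn : n ≠ 0) :
    (bicircularSimplex n).SpliceGenerated := by
  have : NeZero n := ⟨hn⟩
  refine spliceGenerated_transversalMatroid _ finite_univ univ_nonempty (fun i ↦ s(i, i))
    (fun _ ↦ mem_univ _) fun i j ↦ ?_
  simp

theorem bicircularSimplexEdges_indep_iff {n : ℕ} {I : Set (Sym2 (Fin n))} :
    (bicircularSimplexEdges n).Indep I ↔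
      I ⊆ {e | ¬ e.IsDiag} ∧ IsPartialTransversal (fun v : Fin n ↦ {e | v ∈ e}) I := by
  rw [bicircularSimplexEdges, bicircularSimplex, restrict_indep_iff, transversalMatroid_indep_iff]
  simp [and_comm]

theorem bicircularSimplexEdges_isMinor (n : ℕ) :
    (bicircularSimplexEdges n).IsMinor (bicircularSimplex n) :=
  by
  refine ⟨∅, {e | e.IsDiag}, ?_⟩
  rw [contract_empty, ← restrict_compl, bicircularSimplexEdges]
  congr 1
  ext e
  simp [bicircularSimplex]

/-- A set of elements whose members are on a face of the simplex has rank at most the number of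
vertices of the face. -/
theorem bicircularSimplexEdges_eRk_le {n : ℕ} {X : Set (Sym2 (Fin n))} {W : Set (Fin n)}
    (h : ∀ e ∈ X, ∀ v ∈ e, v ∈ W) : (bicircularSimplexEdges n).eRk X ≤ W.encard := by
  refine eRk_le_iff.2 fun I hIX hI ↦ ?_
  obtain ⟨φ, hφ, hφA⟩ := (bicircularSimplexEdges_indep_iff.1 hI).2
  have hφW : ∀ x : I, φ x ∈ W := fun x ↦ h x (hIX x.2) _ (hφA x)
  exact Function.Embedding.encard_le ⟨fun x : I ↦ (⟨φ x, hφW x⟩ : W),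
    fun x y hxy ↦ hφ (congrArg Subtype.val hxy)⟩

theorem spliceIrreducible_bicircularSimplexEdges {n : ℕ} (hn : 5 ≤ n) :
    (bicircularSimplexEdges n).SpliceIrreducible := by
  classical
  rintro ⟨A, B, hsep, ⟨a, haA, haB⟩, ⟨b, hbB, hbA⟩⟩
  have hfin := hsep.finite
  have hU := hsep.1
  have hab : a ≠ b := by rintro rfl; exact hbA haA
  have haE : ¬ a.IsDiag := (hU ▸ subset_union_left : A ⊆ _) haA
  have hbE : ¬ b.IsDiag := (hU ▸ subset_union_right : B ⊆ _) hbB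
  have hr := (isFreeSeparator_iff hfin hU).1 hsep
  -- Two distinct edges cannot have the same ends, so some end `w` of `a` is not on `b`.
  obtain ⟨w, hwa, hwb⟩ : ∃ w ∈ a, w ∉ b := by
    induction a with | _ x y =>
    by_contra! hcon
    exact hab ((Sym2.mem_and_mem_iff (by simpa using haE)).1
      ⟨hcon x (Sym2.mem_mk_left _ _), hcon y (Sym2.mem_mk_right _ _)⟩).symm
  induction b with | _ p q =>
  have hpq : p ≠ q := by simpa using hbE
  have hwp : w ≠ p := by rintro rfl; exact hwb (Sym2.mem_mk_left _ _)
  have hwq : w ≠ q := by rintro rfl; exact hwb (Sym2.mem_mk_right _ _)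
  -- Together with `w`, `p`, `q`, the vertices `u` and `v` make five distinct vertices; this is
  -- where `5 ≤ n` is used.
  obtain ⟨u, hu⟩ : ∃ u, u ∉ ({w, p, q} : Finset (Fin n)) := by
    by_contra! hcon
    have := Finset.card_le_card (fun x _ ↦ hcon x : Finset.univ ⊆ _)
    have := Finset.card_le_three (a := w) (b := p) (c := q)
    simp at *; omega
  obtain ⟨v, hv⟩ : ∃ v, v ∉ ({w, p, q, u} : Finset (Fin n)) := by
    by_contra! hcon
    have := Finset.card_le_card (fun x _ ↦ hcon x : Finset.univ ⊆ _)
    have := Finset.card_le_four (a := w) (b := p) (c := q) (d := u)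
    simp at *; omega
  simp only [Finset.mem_insert, Finset.mem_singleton, not_or] at hu hv
  obtain ⟨huw, hup, huq⟩ := hu
  obtain ⟨hvw, hvp, hvq, hvu⟩ := hv
  -- The 4-cycle `p u q v`, of which `s(p, q)` is a chord. It avoids `w`, so `a` is not in it.
  let I : Set (Sym2 (Fin n)) := {s(p, u), s(u, q), s(q, v), s(v, p)}
  have hIcard : I.encard = 4 := by
    rw [encard_insert_of_notMem, encard_insert_of_notMem, encard_pair]
    · norm_num
    all_goals
      simp only [mem_insert_iff, mem_singleton_iff, Sym2.eq_iff, ne_eq]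
      grind
  have haI : a ∉ I := by
    intro h
    obtain rfl | rfl | rfl | rfl := h <;> simp [*, Ne.symm huw, Ne.symm hvw] at hwa
  have hbI : s(p, q) ∉ I := by
    simp only [I, mem_insert_iff, mem_singleton_iff, Sym2.eq_iff]
    grind
  have hIE : insert a I ⊆ {e | ¬ e.IsDiag} := by
    rintro e (rfl | rfl | rfl | rfl | rfl)
    · exact haE
    all_goals simp [*, Ne.symm]
  have hJ : (bicircularSimplexEdges n).Indep (insert a I) := by
    refine bicircularSimplexEdges_indep_iff.2 ⟨hIE, ?_⟩
    -- Going round the cycle, each vertex takes the edge that leaves it. The default value `a`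
    -- serves the vertex `w`.
    refine isPartialTransversal_of_section (fun i ↦ if i = p then s(p, u) else
      if i = u then s(u, q) else if i = q then s(q, v) else if i = v then s(v, p) else a) ?_
    rintro e (rfl | rfl | rfl | rfl | rfl)
    · exact ⟨w, by simp [*, Ne.symm huw, Ne.symm hvw], hwa⟩
    · exact ⟨p, by simp⟩
    · exact ⟨u, by simp [*]⟩
    · exact ⟨q, by simp [*, Ne.symm hpq, Ne.symm huq]⟩
    · exact ⟨v, by simp [*]⟩
  have hI := hJ.subset (subset_insert a I)
  have hJr : (bicircularSimplexEdges n).eRk (insert a I) = 5 := by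
    rw [hJ.eRk_eq_encard, encard_insert_of_notMem haI, hIcard]; norm_num
  have hX := hr (insert s(p, q) I) (insert_subset hbE hI.subset_ground)
  have hX4 : (bicircularSimplexEdges n).eRk (insert s(p, q) I) ≤ 4 := by
    refine (bicircularSimplexEdges_eRk_le (W := ({p, q, u, v} : Finset (Fin n))) ?_).trans ?_
    · rintro e (rfl | rfl | rfl | rfl | rfl) <;> simp
    · rw [encard_coe_eq_coe_finsetCard]
      exact_mod_cast Finset.card_le_four
  -- As `s(p, q)` is not in `A`, the part of the set in `A` is independent, and the first term of
  -- the minimum is the full cardinality 5.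
  have hXA : insert s(p, q) I ∩ A ⊆ I := fun e he ↦
    he.1.resolve_left fun h ↦ hbA (h ▸ he.2)
  rw [(hI.subset hXA).eRk_eq_encard, add_comm, encard_sdiff_add_encard_inter,
    encard_insert_of_notMem hbI, hIcard] at hX
  -- The second term is also at least 5, since `A - B` contains `a`.
  have h5 : (bicircularSimplexEdges n).eRk (insert a I) ≤
      (bicircularSimplexEdges n).eRk (insert s(p, q) I ∪ A \ B) :=
    eRk_mono _ (insert_subset (Or.inr ⟨haA, haB⟩) ((subset_insert _ _).trans subset_union_left))
  rw [hJr] at h5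
  rw [hX] at hX4
  have : (5 : ℕ∞) ≤ 4 := (le_min (by norm_num) h5).trans hX4
  exact absurd this (by norm_num)

theorem not_spliceGenerated_bicircularSimplexEdges {n : ℕ} (hn : 5 ≤ n) :
    ¬ (bicircularSimplexEdges n).SpliceGenerated := by
  intro h
  obtain ⟨e, he⟩ := h.exists_ground_eq_singleton (spliceIrreducible_bicircularSimplexEdges hn)
  have hmem : ∀ i j : Fin n, i ≠ j → s(i, j) = e := fun i j hij ↦ by
    rw [← mem_singleton_iff, ← he]
    change ¬ s(i, j).IsDiag
    simpa using hij
  -- A one-element ground set would identify the distinct edges `01` and `02`.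
  have := (hmem ⟨0, by omega⟩ ⟨1, by omega⟩ (by simp)).trans
    (hmem ⟨0, by omega⟩ ⟨2, by omega⟩ (by simp)).symm
  simp at this

end Matroid

theorem proposition7p2 :
    -- every fundamental transversal matroid (on a nonempty set) is in the class
    (∀ (α : Type*) (M : Matroid α), M.E.Nonempty → M.IsFundamentalTransversal →
      M.SpliceGenerated) ∧
    -- the class is closed under duality
    (∀ (α : Type*) (M : Matroid α), M.SpliceGenerated → M.dual.SpliceGenerated) ∧
    -- the class is not closed under taking minors (with nonempty ground sets)
    (∃ (α : Type) (M N : Matroid α), M.SpliceGenerated ∧ N.IsMinor M ∧ N.E.Nonempty ∧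
      ¬ N.SpliceGenerated) ∧
    -- an explicit family of witnesses
    (∀ n : ℕ, 5 ≤ n →
      (Matroid.bicircularSimplex n).SpliceGenerated ∧
      (Matroid.bicircularSimplexEdges n).IsMinor (Matroid.bicircularSimplex n) ∧
      (Matroid.bicircularSimplexEdges n).SpliceIrreducible ∧
      ¬ (Matroid.bicircularSimplexEdges n).SpliceGenerated) := by
  refine ⟨fun _ _ hne h ↦ h.spliceGenerated hne, fun _ _ h ↦ h.dual, ?_, fun n hn ↦
    ⟨Matroid.spliceGenerated_bicircularSimplex (by omega), Matroid.bicircularSimplexEdges_isMinor n,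
      Matroid.spliceIrreducible_bicircularSimplexEdges hn,
      Matroid.not_spliceGenerated_bicircularSimplexEdges hn⟩⟩
  refine ⟨_, _, _, Matroid.spliceGenerated_bicircularSimplex (n := 5) (by omega),
    Matroid.bicircularSimplexEdges_isMinor 5, ⟨s(0, 1), ?_⟩,
    Matroid.not_spliceGenerated_bicircularSimplexEdges le_rfl⟩
  change ¬ (s(0, 1) : Sym2 (Fin 5)).IsDiag
  simp
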